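/- **Conventions.** For a partial order $M$, let $M^D$ be its Dedekind–MacNeille completion, i.e. the set of all $J\subseteq M$ that are nonempty, bounded above and equal to the set of lower bounds of their set of upper bounds, ordered by inclusion; identify $x\in M$ with $\{y : y\le x\}$. A *connecting set* from $a\in M$ to $b\in M$ is a tuple $c_1=a,c_2,\dots,c_n=b$ ($n\ge 2$) in $M^D$ whose consecutive terms are comparable and such that each interior $c_i$ is strictly above both, or strictly below both, of $c_{i-1},c_{i+1}$. A *path* from $a$ to $b$ is a union $\sigma_1\cup\dots\cup\sigma_{n-1}$, where $c_1,\dots,c_n$ is a connecting set from $a$ to $b$ (its terms are the *turning points* of the path), $\sigma_k\subseteq M^D$ is a maximal chain with endpoints $c_k,c_{k+1}$, and $x\in\sigma_i\cap\sigma_j$ with $i<j$ implies $j=i+1$ and $x=c_{i+1}$. $M$ is a *cycle-free partial order* (CFPO) if there is at most one path between any two points of $M$, and *connected* if there is at least one. Partial orders may carry an arbitrary family of unary colour predicates, and automorphisms preserve the order and all colours. A *coloured tree* is a partial order with unary predicates in which the elements below any given element are linearly ordered and any two elements have a common lower bound. Two permutation groups are *isomorphic as permutation groups* if there are a group isomorphism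 and a bijection of the underlying sets that respect the actions. **Theorem.** Let $M$ be a connected (possibly coloured) CFPO and let $r\in M$ be fixed by every automorphism of $M$. Assume that all turning points of paths in $M$ that start at $r$ belong to $M$ (this holds for instance if $M=M^D$). Define on the set $M$ the relation $s\le_T t$ if and only if $s$ lies on the path from $r$ to $t$. Put $X_0=\{t: r\le t\}$, $Y_0=\{t : t<r\}$ and, for $n\ge 1$, $$X_n=\{t : y\le t\text{ for some }y\in Y_{n-1}\}\setminus\bigcup_{i<n}(X_i\cup Y_i),\qquad Y_n=\{t : t<x\text{ for some }x\in X_{n-1}\}\setminus\bigcup_{i<n}(X_i\cup Y_i),$$ and let $U$ be the unary predicate that holds exactly on $X=\bigcup_n X_n$. Let $T(M)$ be the set $M$ with the relation $\le_T$, the colours of $M$, and the additional predicate $U$. Then $T(M)$ is a coloured tree, and $\mathrm{Aut}(M)$ and $\mathrm{Aut}(T(M))$ are isomorphic as permutation groups. -/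

import Mathlib

open Set

/-- The Dedekind–MacNeille completion `M^D` used for cycle-free partial orders: the cuts
`(L, R)` of `M` with `L` nonempty and bounded above, that is with both halves nonempty.  (No new
least or greatest element is added.) -/
def MDCompletion (M : Type*) [PartialOrder M] : Type _ :=
  {A : DedekindCut M // A.left.Nonempty ∧ A.right.Nonempty}

instance MDCompletion.instPartialOrder (M : Type*) [PartialOrder M] :
    PartialOrder (MDCompletion M) :=
  inferInstanceAs
    (PartialOrder {A : DedekindCut M // A.left.Nonempty ∧ A.right.Nonempty})

/-- The canonical embedding of `M` in `M^D`. -/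
def toMD {M : Type*} [PartialOrder M] (x : M) : MDCompletion M :=
  ⟨DedekindCut.principal x, ⟨x, self_mem_Iic⟩, ⟨x, self_mem_Ici⟩⟩

theorem toMD_le_toMD {M : Type*} [PartialOrder M] {x y : M} :
    toMD x ≤ toMD y ↔ x ≤ y :=
  DedekindCut.principal_le_principal

/-- `c 0, c 1, …, c n` is a connecting set from `a` to `b` (an `(n+1)`-tuple, `n ≥ 1`):
consecutive terms are comparable, and every interior term is strictly above both of its
neighbours or strictly below both of them. -/
structure IsConnectingSet {M : Type*} [PartialOrder M] (a b : M) (n : ℕ)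
    (c : Fin (n + 1) → MDCompletion M) : Prop where
  one_le : 1 ≤ n
  first : c 0 = toMD a
  last : c (Fin.last n) = toMD b
  comparable : ∀ k : Fin n, c k.castSucc ≤ c k.succ ∨ c k.succ ≤ c k.castSucc
  alternating : ∀ i j : Fin n, (j : ℕ) = i + 1 →
    (c i.castSucc < c i.succ ∧ c j.succ < c i.succ) ∨
      (c i.succ < c i.castSucc ∧ c i.succ < c j.succ)

/-- `S` is a maximal chain of `P` among the chains with endpoints `u` and `v`. -/
def IsMaxChainBetween {P : Type*} [PartialOrder P] (u v : P) (S : Set P) : Prop :=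
  Maximal (fun s : Set P => IsChain (· ≤ ·) s ∧ u ∈ s ∧ v ∈ s ∧ s ⊆ Icc u v ∪ Icc v u) S

/-- `P` is a path from `a` to `b` in `M`, with connecting set `c 0, …, c n`: it is the union of
maximal chains `σ k` with endpoints `c k` and `c (k+1)`, where two of these chains meet only if
they are consecutive, and then only in their common endpoint. -/
def IsPathVia {M : Type*} [PartialOrder M] (a b : M) (n : ℕ)
    (c : Fin (n + 1) → MDCompletion M) (P : Set (MDCompletion M)) : Prop :=
  IsConnectingSet a b n c ∧
    ∃ σ : Fin n → Set (MDCompletion M),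
      (∀ k, IsMaxChainBetween (c k.castSucc) (c k.succ) (σ k)) ∧
      (∀ i j : Fin n, i < j → ∀ x ∈ σ i ∩ σ j, (j : ℕ) = i + 1 ∧ x = c i.succ) ∧
      P = ⋃ k, σ k

/-- `P ⊆ M^D` is a path from `a` to `b` in `M`. -/
def IsPath {M : Type*} [PartialOrder M] (a b : M) (P : Set (MDCompletion M)) : Prop :=
  ∃ (n : ℕ) (c : Fin (n + 1) → MDCompletion M), IsPathVia a b n c P

/-- `M` is a cycle-free partial order: between any two points there is at most one path. -/
def IsCFPO (M : Type*) [PartialOrder M] : Prop :=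
  ∀ (x y : M) (P Q : Set (MDCompletion M)), IsPath x y P → IsPath x y Q → P = Q

/-- `M` is connected: between any two points there is a path. -/
def IsPathConnectedOrder (M : Type*) [PartialOrder M] : Prop :=
  ∀ x y : M, ∃ P : Set (MDCompletion M), IsPath x y P

/-- Every path in `M` that starts at `r` has all its turning points (the terms of its connecting
set) in `M`, rather than merely in `M^D`. -/
def TurningPointsIn {M : Type*} [PartialOrder M] (r : M) : Prop :=
  ∀ (t : M) (n : ℕ) (c : Fin (n + 1) → MDCompletion M) (P : Set (MDCompletion M)),
    IsPathVia r t n c P → ∀ k, c k ∈ range (toMD : M → MDCompletion M)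

/-- A set with a binary relation and a family of unary (colour) predicates. -/
structure ColouredRel (α ι : Type*) where
  le : α → α → Prop
  colour : ι → Set α

/-- The automorphism group, as a group of permutations of the underlying set. -/
def ColouredRel.Aut {α ι : Type*} (S : ColouredRel α ι) : Subgroup (Equiv.Perm α) where
  carrier := {g | (∀ x y, S.le (g x) (g y) ↔ S.le x y) ∧ ∀ i x, g x ∈ S.colour i ↔ x ∈ S.colour i}
  one_mem' := ⟨fun _ _ => Iff.rfl, fun _ _ => Iff.rfl⟩
  mul_mem' := fun {g h} hg hh =>
    ⟨fun x y => (hg.1 (h x) (h y)).trans (hh.1 x y),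
      fun i x => (hg.2 i (h x)).trans (hh.2 i x)⟩
  inv_mem' := fun {g} hg =>
    ⟨fun x y => by simpa using (hg.1 (g⁻¹ x) (g⁻¹ y)).symm,
      fun i x => by simpa using (hg.2 i (g⁻¹ x)).symm⟩

/-- A coloured tree: a partial order with arbitrary unary predicates in which the elements below
a given one are linearly ordered and any two elements have a common lower bound. -/
structure ColouredRel.IsTree {α ι : Type*} (S : ColouredRel α ι) : Prop where
  refl : ∀ x, S.le x x
  trans : ∀ x y z, S.le x y → S.le y z → S.le x z
  antisymm : ∀ x y, S.le x y → S.le y x → x = y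
  linear_below : ∀ t x y, S.le x t → S.le y t → S.le x y ∨ S.le y x
  common_lower_bound : ∀ x y, ∃ z, S.le z x ∧ S.le z y

/-- Isomorphism of permutation groups: a group isomorphism together with a bijection of the
underlying sets that is compatible with the actions. -/
def PermGroupIso {α β : Type*} (G : Subgroup (Equiv.Perm α)) (H : Subgroup (Equiv.Perm β)) :
    Prop :=
  ∃ (φ : G ≃* H) (e : α ≃ β), ∀ (g : G) (a : α),
    e ((g : Equiv.Perm α) a) = (φ g : Equiv.Perm β) (e a)

/-- The triple `(X_n, Y_n, ⋃ i ≤ n, X_i ∪ Y_i)`. -/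
def layerData {M : Type*} [PartialOrder M] (r : M) : ℕ → Set M × Set M × Set M
  | 0 => ({t | r ≤ t}, {t | t < r}, {t | r ≤ t} ∪ {t | t < r})
  | n + 1 =>
    let X := {t | ∃ y ∈ (layerData r n).2.1, y ≤ t} \ (layerData r n).2.2
    let Y := {t | ∃ x ∈ (layerData r n).1, t < x} \ (layerData r n).2.2
    (X, Y, (layerData r n).2.2 ∪ (X ∪ Y))

/-- The upward layer `X_n`. -/
def layerX {M : Type*} [PartialOrder M] (r : M) (n : ℕ) : Set M := (layerData r n).1

/-- The downward layer `Y_n`. -/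
def layerY {M : Type*} [PartialOrder M] (r : M) (n : ℕ) : Set M := (layerData r n).2.1

theorem layerData_union {M : Type*} [PartialOrder M] (r : M) (n : ℕ) :
    (layerData r n).2.2 = ⋃ i < n + 1, layerX r i ∪ layerY r i := by
  induction n with
  | zero => simp [layerData, layerX, layerY]
  | succ n ih =>
    rw [biUnion_lt_succ, ← ih]
    rfl

theorem layerX_zero {M : Type*} [PartialOrder M] (r : M) : layerX r 0 = {t | r ≤ t} := rfl

theorem layerY_zero {M : Type*} [PartialOrder M] (r : M) : layerY r 0 = {t | t < r} := rfl

theorem layerX_succ {M : Type*} [PartialOrder M] (r : M) (n : ℕ) :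
    layerX r (n + 1) =
      {t | ∃ y ∈ layerY r n, y ≤ t} \ ⋃ i < n + 1, layerX r i ∪ layerY r i := by
  rw [← layerData_union]
  rfl

theorem layerY_succ {M : Type*} [PartialOrder M] (r : M) (n : ℕ) :
    layerY r (n + 1) =
      {t | ∃ x ∈ layerX r n, t < x} \ ⋃ i < n + 1, layerX r i ∪ layerY r i := by
  rw [← layerData_union]
  rfl

/-- The coloured structure `(M, ≤, C)` itself. -/
def colouredOrder {M ι : Type*} [PartialOrder M] (C : ι → Set M) : ColouredRel M ι where
  le := (· ≤ ·)
  colour := C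

/-- The structure `T(M)` on the set `M`: `s` is below `t` if `s` lies on the path from `r` to `t`;
the colours are those of `M` (indexed by `some i`) and the new predicate `U` (indexed by `none`),
which holds exactly on the union of the layers `X_n`. -/
def treeOf {M ι : Type*} [PartialOrder M] (C : ι → Set M) (r : M) :
    ColouredRel M (Option ι) where
  le s t := ∃ P, IsPath r t P ∧ toMD s ∈ P
  colour
    | none => ⋃ n, layerX r n
    | some i => C i

/-!
A path from `r` is a sequence of maximal chains ("links") that go alternately up and down.  For
`t ≠ r` cycle-freeness makes the direction of the last link of the path to `t`, and the number of
its links, functions of `t`: otherwise a step from `t` back to an earlier point of the path would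
yield a second path to `t`.  By induction the layers `X_n` and `Y_n` collect the points reached
with `n + 1` links the last of which goes up, respectively down, so `U` records the last direction.

This makes the order of `M` definable in `T(M)`: `s ≤ t` holds if and only if there is a `z` with
`z ≤_T s` and `z ≤_T t` such that the points of `(z, s]` are all reached downwards and those of
`(z, t]` all upwards.  The witness `z` is the first point of the path from `r` to `s` in the
interval `[s, t]`; it lies in `M` because it is `s`, `t` or a turning point.  It exists because
chains in `M^D` have infima and suprema, and maximal chains contain them.  So automorphisms of
`T(M)` preserve `≤`; conversely, those of `M` fix `r` and hence carry over the whole construction,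
and the two groups are equal.
-/

section Intervals

variable {P : Type*} [PartialOrder P] {u v p x y a c : P} {T : Set P}

/-- The closed interval with endpoints `u` and `v`, whichever way round they are comparable (and
empty if they are incomparable): the version of `Set.uIcc` for a partial order. -/
def symmIcc (u v : P) : Set P := Icc u v ∪ Icc v u

theorem mem_symmIcc : x ∈ symmIcc u v ↔ u ≤ x ∧ x ≤ v ∨ v ≤ x ∧ x ≤ u := Iff.rfl

theorem symmIcc_of_le (h : u ≤ v) : symmIcc u v = Icc u v :=
  union_eq_left.2 fun _ hx => ⟨h.trans hx.1, hx.2.trans h⟩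

theorem symmIcc_comm (u v : P) : symmIcc u v = symmIcc v u := union_comm _ _

theorem symmIcc_self (u : P) : symmIcc u u = {u} := by
  rw [symmIcc_of_le le_rfl, Icc_self]

theorem left_mem_symmIcc (h : u ≤ v ∨ v ≤ u) : u ∈ symmIcc u v :=
  h.imp (fun h => ⟨le_rfl, h⟩) fun h => ⟨h, le_rfl⟩

theorem right_mem_symmIcc (h : u ≤ v ∨ v ≤ u) : v ∈ symmIcc u v :=
  h.imp (fun h => ⟨h, le_rfl⟩) fun h => ⟨le_rfl, h⟩

theorem symmIcc_subset_symmIcc (hu : u ∈ symmIcc a c) (hv : v ∈ symmIcc a c) :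
    symmIcc u v ⊆ symmIcc a c := by
  intro x
  grind [mem_symmIcc]

theorem eq_of_mem_symmIcc_of_mem_symmIcc (hx : x ∈ symmIcc u y) (hy : y ∈ symmIcc u x) :
    x = y := by
  grind [mem_symmIcc]

theorem isGLB_mem_symmIcc (hp : IsGLB T p) (hT : T ⊆ symmIcc u v) (hne : T.Nonempty) :
    p ∈ symmIcc u v := by
  obtain ⟨t, ht⟩ := hne
  wlog huv : u ≤ v generalizing u v
  · rw [symmIcc_comm] at hT ⊢
    exact this hT ((hT ht).elim (fun h => h.1.trans h.2) fun h => absurd (h.1.trans h.2) huv)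
  rw [symmIcc_of_le huv] at hT ⊢
  exact ⟨hp.2 fun _ hx => (hT hx).1, (hp.1 ht).trans (hT ht).2⟩

theorem isLUB_mem_symmIcc (hp : IsLUB T p) (hT : T ⊆ symmIcc u v) (hne : T.Nonempty) :
    p ∈ symmIcc u v :=
  (isGLB_mem_symmIcc (P := Pᵒᵈ) hp (fun _ hx => (hT hx).symm.imp And.symm And.symm) hne).symm.imp
    And.symm And.symm

end Intervals

section MaximalChains

variable {P : Type*} [PartialOrder P] {u v p x y : P} {S T : Set P}

namespace IsMaxChainBetween

theorem left_mem (h : IsMaxChainBetween u v S) : u ∈ S := h.prop.2.1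

theorem right_mem (h : IsMaxChainBetween u v S) : v ∈ S := h.prop.2.2.1

theorem subset_symmIcc (h : IsMaxChainBetween u v S) : S ⊆ symmIcc u v := h.prop.2.2.2

theorem total (h : IsMaxChainBetween u v S) (hx : x ∈ S) (hy : y ∈ S) : x ≤ y ∨ y ≤ x :=
  h.prop.1.total hx hy

theorem mem_of_forall_comparable (h : IsMaxChainBetween u v S) (hx : x ∈ symmIcc u v)
    (hc : ∀ y ∈ S, x ≤ y ∨ y ≤ x) : x ∈ S :=
  h.le_of_ge ⟨h.prop.1.insert fun y hy _ => hc y hy, mem_insert_of_mem _ h.left_mem,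
    mem_insert_of_mem _ h.right_mem, insert_subset hx h.subset_symmIcc⟩ (subset_insert _ _)
    (mem_insert _ _)

end IsMaxChainBetween

theorem isMaxChainBetween_iff : IsMaxChainBetween u v S ↔
    IsChain (· ≤ ·) S ∧ u ∈ S ∧ v ∈ S ∧ S ⊆ symmIcc u v ∧
      ∀ x ∈ symmIcc u v, (∀ y ∈ S, x ≤ y ∨ y ≤ x) → x ∈ S :=
  ⟨fun h => ⟨h.prop.1, h.left_mem, h.right_mem, h.subset_symmIcc,
      fun _ => h.mem_of_forall_comparable⟩,
    fun ⟨hS, hu, hv, hsub, hmax⟩ => ⟨⟨hS, hu, hv, hsub⟩, fun _ hT hST x hx =>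
      hmax x (hT.2.2.2 hx) fun _ hy => hT.1.total hx (hST hy)⟩⟩

theorem exists_isMaxChainBetween (huv : u ≤ v ∨ v ≤ u) : ∃ S, IsMaxChainBetween u v S := by
  have hpair : ({u, v} : Set P) ⊆ symmIcc u v :=
    insert_subset (left_mem_symmIcc huv) (singleton_subset_iff.2 (right_mem_symmIcc huv))
  have hchain : IsChain (· ≤ ·) ({u, v} : Set P) := by
    rintro x (rfl | rfl) y (rfl | rfl) - <;> grind
  obtain ⟨S, -, hS⟩ := zorn_subset_nonempty
    {s : Set P | IsChain (· ≤ ·) s ∧ u ∈ s ∧ v ∈ s ∧ s ⊆ symmIcc u v} (by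
      rintro c hcS hc ⟨s, hs⟩
      refine ⟨⋃₀ c, ⟨?_, ⟨s, hs, (hcS hs).2.1⟩, ⟨s, hs, (hcS hs).2.2.1⟩,
        sUnion_subset fun t ht => (hcS ht).2.2.2⟩, fun s hs => subset_sUnion_of_mem hs⟩
      rintro x ⟨a, ha, hxa⟩ y ⟨b, hb, hyb⟩ hne
      rcases hc.total ha hb with hab | hba
      · exact (hcS hb).1 (hab hxa) hyb hne
      · exact (hcS ha).1 hxa (hba hyb) hne)
    {u, v} ⟨hchain, mem_insert _ _, mem_insert_of_mem _ rfl, hpair⟩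
  exact ⟨S, hS⟩

theorem isMaxChainBetween_singleton (u : P) : IsMaxChainBetween u u {u} := by
  simp [isMaxChainBetween_iff, symmIcc_self, subsingleton_singleton.isChain]

namespace IsMaxChainBetween

theorem truncate (h : IsMaxChainBetween u v S) (hp : p ∈ S) :
    IsMaxChainBetween u p (S ∩ symmIcc u p) := by
  have hup := h.total h.left_mem hp
  refine isMaxChainBetween_iff.2 ⟨h.prop.1.mono inter_subset_left,
    ⟨h.left_mem, left_mem_symmIcc hup⟩, ⟨hp, right_mem_symmIcc hup⟩, inter_subset_right,
    fun x hx hc => ⟨?_, hx⟩⟩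
  refine h.mem_of_forall_comparable (symmIcc_subset_symmIcc
    (left_mem_symmIcc (h.total h.left_mem h.right_mem)) (h.subset_symmIcc hp) hx) fun y hy => ?_
  have hyp := h.total hy hp
  have hyu := h.total hy h.left_mem
  by_cases hy' : y ∈ symmIcc u p
  · exact hc y ⟨hy, hy'⟩
  · grind [mem_symmIcc]

theorem union (h : IsMaxChainBetween u p S) (h' : IsMaxChainBetween p v T)
    (hp : p ∈ symmIcc u v) : IsMaxChainBetween u v (S ∪ T) := by
  have huv : u ≤ v ∨ v ≤ u := hp.imp (fun h => h.1.trans h.2) fun h => h.1.trans h.2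
  have hS := h.subset_symmIcc
  have hT := h'.subset_symmIcc
  have hST : ∀ x ∈ S, ∀ y ∈ T, x ≤ y ∨ y ≤ x := fun x hx y hy => by
    have := hS hx; have := hT hy
    grind [mem_symmIcc]
  refine isMaxChainBetween_iff.2 ⟨?_, Or.inl h.left_mem, Or.inr h'.right_mem, union_subset
    (hS.trans (symmIcc_subset_symmIcc (left_mem_symmIcc huv) hp))
    (hT.trans (symmIcc_subset_symmIcc hp (right_mem_symmIcc huv))), fun x hx hc => ?_⟩
  · rintro x (hx | hx) y (hy | hy) -
    · exact h.total hx hy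
    · exact hST x hx y hy
    · exact (hST y hy x hx).symm
    · exact h'.total hx hy
  · have hxp := hc p (Or.inl h.right_mem)
    have hx' : x ∈ symmIcc u p ∨ x ∈ symmIcc p v := by grind [mem_symmIcc]
    exact hx'.imp (h.mem_of_forall_comparable · fun y hy => hc y (Or.inl hy))
      (h'.mem_of_forall_comparable · fun y hy => hc y (Or.inr hy))

theorem mem_symmIcc_or_mem_symmIcc (h : IsMaxChainBetween u v S) (hx : x ∈ S) (hy : y ∈ S) :
    x ∈ symmIcc u y ∨ y ∈ symmIcc u x := by
  have := h.total hx hy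
  have := h.subset_symmIcc hx
  have := h.subset_symmIcc hy
  grind [mem_symmIcc]

theorem mem_of_isGLB (h : IsMaxChainBetween u v S) (hTS : T ⊆ S) (hne : T.Nonempty)
    (hp : IsGLB T p) : p ∈ S := by
  refine h.mem_of_forall_comparable (isGLB_mem_symmIcc hp (hTS.trans h.subset_symmIcc) hne)
    fun x hx => or_iff_not_imp_right.2 fun hxp => ?_
  obtain ⟨w, hw, hxw⟩ : ∃ w ∈ T, ¬ x ≤ w := by
    by_contra! hlower
    exact hxp (hp.2 hlower)
  exact (hp.1 hw).trans ((h.total hx (hTS hw)).resolve_left hxw)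

theorem mem_of_isLUB (h : IsMaxChainBetween u v S) (hTS : T ⊆ S) (hne : T.Nonempty)
    (hp : IsLUB T p) : p ∈ S := by
  refine h.mem_of_forall_comparable (isLUB_mem_symmIcc hp (hTS.trans h.subset_symmIcc) hne)
    fun x hx => or_iff_not_imp_left.2 fun hpx => ?_
  obtain ⟨w, hw, hwx⟩ : ∃ w ∈ T, ¬ w ≤ x := by
    by_contra! hupper
    exact hpx (hp.2 hupper)
  exact ((h.total hx (hTS hw)).resolve_right hwx).trans (hp.1 hw)

theorem image {Q : Type*} [PartialOrder Q] (h : IsMaxChainBetween u v S) (φ : P ≃o Q) :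
    IsMaxChainBetween (φ u) (φ v) (φ '' S) := by
  refine isMaxChainBetween_iff.2 ⟨?_, mem_image_of_mem _ h.left_mem,
    mem_image_of_mem _ h.right_mem, ?_, fun x hx hc => ⟨φ.symm x, ?_, φ.apply_symm_apply x⟩⟩
  · rintro _ ⟨x, hx, rfl⟩ _ ⟨y, hy, rfl⟩ -
    simpa only [φ.le_iff_le] using h.total hx hy
  · rintro _ ⟨x, hx, rfl⟩
    simpa only [mem_symmIcc, φ.le_iff_le] using h.subset_symmIcc hx
  · refine h.mem_of_forall_comparable ?_ fun y hy => ?_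
    · simpa only [mem_symmIcc, φ.le_symm_apply, φ.symm_apply_le] using hx
    · simpa only [φ.le_symm_apply, φ.symm_apply_le] using hc _ (mem_image_of_mem φ hy)

end IsMaxChainBetween

theorem IsMaxChainBetween.exists_first_mem {P : Type*} [ConditionallyCompletePartialOrder P]
    {u v a c : P} {S : Set P} (h : IsMaxChainBetween u v S)
    (hne : (S ∩ symmIcc a c).Nonempty) :
    ∃ p ∈ S ∩ symmIcc a c, ∀ x ∈ S ∩ symmIcc a c, x ∈ symmIcc u p → x = p := by
  have hchain : IsChain (· ≤ ·) (S ∩ symmIcc a c) := h.prop.1.mono inter_subset_left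
  rcases h.total h.left_mem h.right_mem with huv | hvu
  · have hS := symmIcc_of_le huv ▸ h.subset_symmIcc
    have hp := DirectedOn.isGLB_csInf (IsChain.directedOn (r := (· ≥ ·)) hchain.symm) hne
      ⟨u, fun x hx => (hS hx.1).1⟩
    have hpS := h.mem_of_isGLB inter_subset_left hne hp
    refine ⟨_, ⟨hpS, isGLB_mem_symmIcc hp inter_subset_right hne⟩, fun x hx hxp => ?_⟩
    rw [symmIcc_of_le (hS hpS).1] at hxp
    exact hxp.2.antisymm (hp.1 hx)
  · have hS := symmIcc_of_le hvu ▸ symmIcc_comm u v ▸ h.subset_symmIcc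
    have hp := DirectedOn.isLUB_csSup hchain.directedOn hne ⟨u, fun x hx => (hS hx.1).2⟩
    have hpS := h.mem_of_isLUB inter_subset_left hne hp
    refine ⟨_, ⟨hpS, isLUB_mem_symmIcc hp inter_subset_right hne⟩, fun x hx hxp => ?_⟩
    rw [symmIcc_comm, symmIcc_of_le (hS hpS).2] at hxp
    exact (hp.1 hx).antisymm hxp.1

end MaximalChains

section Steps

variable {P : Type*} [PartialOrder P] {b : Bool} {x y z u v : P}

/-- `y` lies strictly above `x` (direction `true`) or strictly below it (direction `false`); every
link of a path has one of the two directions. -/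
def IsStep : Bool → P → P → Prop
  | true, x, y => x < y
  | false, x, y => y < x

theorem isStep_not : IsStep (!b) x y ↔ IsStep b y x := by
  cases b <;> rfl

theorem exists_isStep (h : x ≤ y ∨ y ≤ x) (hne : x ≠ y) : ∃ b, IsStep b x y :=
  h.elim (fun h => ⟨true, h.lt_of_ne hne⟩) fun h => ⟨false, h.lt_of_ne' hne⟩

namespace IsStep

theorem ne (h : IsStep b x y) : x ≠ y := by
  cases b
  · exact ne_of_gt h
  · exact ne_of_lt h

theorem trans (h : IsStep b x y) (h' : IsStep b y z) : IsStep b x z := by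
  cases b
  · exact lt_trans h' h
  · exact lt_trans h h'

theorem asymm (h : IsStep b x y) : ¬ IsStep b y x := fun h' => (h.trans h').ne rfl

theorem le_or_le (h : IsStep b x y) : x ≤ y ∨ y ≤ x := by
  cases b
  · exact Or.inr (le_of_lt h)
  · exact Or.inl (le_of_lt h)

theorem mem_symmIcc_iff (h : IsStep b u v) :
    x ∈ symmIcc u v ↔ (x = u ∨ IsStep b u x) ∧ (x = v ∨ IsStep b x v) := by
  cases b
  · rw [symmIcc_comm, symmIcc_of_le (le_of_lt h), mem_Icc, and_comm]
    simp only [IsStep, le_iff_eq_or_lt, eq_comm]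
  · rw [symmIcc_of_le (le_of_lt h), mem_Icc]
    simp only [IsStep, le_iff_eq_or_lt, eq_comm]

end IsStep
end Steps

section Links

variable {P : Type*} [PartialOrder P] {b : Bool} {z w p x a c : P} {A B S T : Set P}

/-- `S` is a link that prolongs a path with point set `A` and endpoint `z` in direction `b`, as far
as `w`: a maximal chain from `z` to `w` that meets `A` at most in `z`. -/
structure IsLink (A : Set P) (b : Bool) (z : P) (S : Set P) (w : P) : Prop where
  step : IsStep b z w
  chain : IsMaxChainBetween z w S
  inter_subset : A ∩ S ⊆ {z}

namespace IsLink

theorem eq_or_isStep_left (h : IsLink A b z S w) (hx : x ∈ S) : x = z ∨ IsStep b z x :=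
  (h.step.mem_symmIcc_iff.1 (h.chain.subset_symmIcc hx)).1

theorem eq_or_isStep_right (h : IsLink A b z S w) (hx : x ∈ S) : x = w ∨ IsStep b x w :=
  (h.step.mem_symmIcc_iff.1 (h.chain.subset_symmIcc hx)).2

theorem right_notMem (h : IsLink A b z S w) : w ∉ A := fun hw =>
  h.step.ne (h.inter_subset ⟨hw, h.chain.right_mem⟩ : w = z).symm

theorem truncate (h : IsLink A b z S w) (hp : p ∈ S) (hpz : p ≠ z) :
    IsLink A b z (S ∩ symmIcc z p) p :=
  ⟨(h.eq_or_isStep_left hp).resolve_left hpz, h.chain.truncate hp,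
    (inter_subset_inter_right _ inter_subset_left).trans h.inter_subset⟩

theorem union (h : IsLink A b z S p) (h' : IsLink (A ∪ S) b p T w) :
    IsLink A b z (S ∪ T) w := by
  have hzw := h.step.trans h'.step
  refine ⟨hzw, h.chain.union h'.chain (hzw.mem_symmIcc_iff.2 ⟨Or.inr h.step, Or.inr h'.step⟩), ?_⟩
  rintro x ⟨hxA, hxS | hxT⟩
  · exact h.inter_subset ⟨hxA, hxS⟩
  · obtain rfl : x = p := h'.inter_subset ⟨Or.inl hxA, hxT⟩
    exact absurd hxA h.right_notMem

end IsLink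

theorem exists_isLink (hp : B ∩ symmIcc a c = {p}) (hx : x ∈ symmIcc a c) (hpx : IsStep b p x) :
    ∃ S, IsLink B b p S x := by
  obtain ⟨S, hS⟩ := exists_isMaxChainBetween hpx.le_or_le
  have hpm : p ∈ B ∩ symmIcc a c := hp.symm.subset rfl
  exact ⟨S, hpx, hS, hp ▸ inter_subset_inter_right _
    (hS.subset_symmIcc.trans (symmIcc_subset_symmIcc hpm.2 hx))⟩

end Links

/-- `A` is the point set of a path from `r` to `z` made of `n` links of alternating directions,
the last of which has direction `b`.  The trivial path `{r}` counts for both directions. -/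
inductive RootPath {P : Type*} [PartialOrder P] (r : P) : ℕ → Bool → Set P → P → Prop
  | nil (b : Bool) : RootPath r 0 b {r} r
  | snoc {n : ℕ} {b : Bool} {A S : Set P} {z w : P} (hA : RootPath r n (!b) A z)
      (hS : IsLink A b z S w) : RootPath r (n + 1) b (A ∪ S) w

namespace RootPath

section PartialOrder

variable {P : Type*} [PartialOrder P] {r z w p x y : P} {n : ℕ} {b d : Bool} {A B S : Set P}

theorem root_mem (h : RootPath r n b A z) : r ∈ A := by
  induction h with
  | nil => rfl
  | snoc _ _ ih => exact Or.inl ih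

theorem end_mem (h : RootPath r n b A z) : z ∈ A := by
  cases h with
  | nil => rfl
  | snoc _ hS => exact Or.inr hS.chain.right_mem

theorem eq_of_zero (h : RootPath r 0 b A z) : z = r ∧ A = {r} := by
  cases h
  exact ⟨rfl, rfl⟩

theorem exists_isLink_of_succ (h : RootPath r (n + 1) b A w) :
    ∃ z B S, RootPath r n (!b) B z ∧ IsLink B b z S w ∧ A = B ∪ S := by
  cases h with
  | snoc hA hS => exact ⟨_, _, _, hA, hS, rfl⟩

theorem exists_append (h : RootPath r n d B p) (hS : IsLink B b p S w) :
    ∃ k, (k = n ∨ k = n + 1) ∧ RootPath r k b (B ∪ S) w := by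
  by_cases hd : d = !b
  · subst hd
    exact ⟨n + 1, Or.inr rfl, .snoc h hS⟩
  obtain rfl : d = b := by simpa using hd
  cases h with
  | nil => exact ⟨1, Or.inr rfl, .snoc (.nil _) hS⟩
  | snoc hA hT => exact ⟨_, Or.inl rfl, union_assoc _ _ _ ▸ .snoc hA (hT.union hS)⟩

theorem truncate (hA : RootPath r n (!b) A z) (hS : IsLink A b z S w) (hp : p ∈ S)
    (hpz : p ≠ z) : RootPath r (n + 1) b (A ∪ S ∩ symmIcc z p) p :=
  .snoc hA (hS.truncate hp hpz)

theorem exists_mem_or_exists_mem (h : RootPath r n b A z) (hx : x ∈ A) (hy : y ∈ A) :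
    (∃ m d B, RootPath r m d B y ∧ x ∈ B) ∨ ∃ m d B, RootPath r m d B x ∧ y ∈ B := by
  induction h with
  | nil b =>
    obtain rfl : x = y := hx.trans hy.symm
    exact Or.inl ⟨0, b, {r}, hx ▸ .nil b, hx⟩
  | @snoc n b A S z w hA hS ih =>
    have hpath : ∀ {p}, p ∈ A ∪ S → p ∉ A → RootPath r (n + 1) b (A ∪ S ∩ symmIcc z p) p :=
      fun hp hpA => hA.truncate hS (hp.resolve_left hpA) fun h => hpA (h ▸ hA.end_mem)
    by_cases hxA : x ∈ A <;> by_cases hyA : y ∈ A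
    · exact ih hxA hyA
    · exact Or.inl ⟨_, _, _, hpath hy hyA, Or.inl hxA⟩
    · exact Or.inr ⟨_, _, _, hpath hx hxA, Or.inl hyA⟩
    · have hxS := hx.resolve_left hxA
      have hyS := hy.resolve_left hyA
      exact (hS.chain.mem_symmIcc_or_mem_symmIcc hxS hyS).imp
        (fun hxy => ⟨_, _, _, hpath hy hyA, Or.inr ⟨hxS, hxy⟩⟩)
        fun hyx => ⟨_, _, _, hpath hx hxA, Or.inr ⟨hyS, hyx⟩⟩

end PartialOrder

section Complete

variable {P : Type*} [ConditionallyCompletePartialOrder P] {r z a c s t : P} {n : ℕ} {b : Bool}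
  {A : Set P}

theorem exists_first_hit (h : RootPath r n b A z) (hne : (A ∩ symmIcc a c).Nonempty) :
    ∃ m d B p, RootPath r m d B p ∧ B ⊆ A ∧ B ∩ symmIcc a c = {p} ∧ (z ∈ B → p = z) := by
  induction h with
  | nil b =>
    obtain ⟨x, rfl, hx⟩ := hne
    exact ⟨0, b, {x}, x, .nil b, subset_rfl, inter_eq_left.2 (singleton_subset_iff.2 hx),
      fun _ => rfl⟩
  | @snoc n b A S z w hA hS ih =>
    by_cases hA' : (A ∩ symmIcc a c).Nonempty
    · obtain ⟨m, d, B, p, hB, hBA, hBp, -⟩ := ih hA'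
      exact ⟨m, d, B, p, hB, hBA.trans subset_union_left, hBp,
        fun hw => absurd (hBA hw) hS.right_notMem⟩
    · have hS' : (S ∩ symmIcc a c).Nonempty :=
        (union_inter_distrib_right .. ▸ hne).elim fun x hx =>
          ⟨x, hx.resolve_left fun h => hA' ⟨x, h⟩⟩
      obtain ⟨p, ⟨hpS, hp⟩, hfirst⟩ := hS.chain.exists_first_mem hS'
      have hpz : p ≠ z := fun h => hA' ⟨p, h ▸ hA.end_mem, hp⟩
      have hpath := hA.truncate hS hpS hpz
      refine ⟨_, _, _, p, hpath, union_subset_union_right _ inter_subset_left,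
        Subset.antisymm ?_ (singleton_subset_iff.2 ⟨hpath.end_mem, hp⟩), ?_⟩
      · rintro x ⟨hx | hx, hx'⟩
        · exact absurd ⟨x, hx, hx'⟩ hA'
        · exact hfirst x ⟨hx.1, hx'⟩ hx.2
      · exact fun hw => eq_of_mem_symmIcc_of_mem_symmIcc (hS.chain.subset_symmIcc hpS)
          (hw.resolve_left hS.right_notMem).2

theorem exists_of_le_or_le (h : RootPath r n b A s) (hst : s ≤ t ∨ t ≤ s) :
    ∃ m d B, RootPath r m d B t := by
  obtain ⟨m, d, B, p, hB, -, hp, -⟩ :=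
    h.exists_first_hit ⟨s, h.end_mem, left_mem_symmIcc hst⟩
  have hpm : p ∈ symmIcc s t := (hp.symm.subset rfl : p ∈ B ∩ symmIcc s t).2
  by_cases hpt : p = t
  · exact ⟨m, d, B, hpt ▸ hB⟩
  obtain ⟨e, he⟩ := exists_isStep (hpm.imp And.right And.left) hpt
  obtain ⟨S, hS⟩ := exists_isLink hp (right_mem_symmIcc hst) he
  obtain ⟨k, -, hk⟩ := hB.exists_append hS
  exact ⟨k, e, _, hk⟩

end Complete

end RootPath

section Completion

variable {M N : Type*} [PartialOrder M] [PartialOrder N]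

theorem toMD_injective : Function.Injective (toMD : M → MDCompletion M) := fun _ _ h =>
  le_antisymm (toMD_le_toMD.1 h.le) (toMD_le_toMD.1 h.ge)

theorem isStep_toMD {b : Bool} {x y : M} : IsStep b (toMD x) (toMD y) ↔ IsStep b x y := by
  cases b <;> simp only [IsStep, lt_iff_le_not_ge, toMD_le_toMD]

namespace MDCompletion

theorem exists_isGLB {S : Set (MDCompletion M)} (hne : S.Nonempty) (hS : BddBelow S) :
    ∃ x, IsGLB S x := by
  obtain ⟨s, hs⟩ := hne
  obtain ⟨a, ha⟩ := hS
  have has : a.1 ≤ sInf (Subtype.val '' S) := le_sInf (forall_mem_image.2 fun _ hx => ha hx)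
  have hsle : sInf (Subtype.val '' S) ≤ s.1 := sInf_le (mem_image_of_mem _ hs)
  exact ⟨⟨sInf (Subtype.val '' S), a.2.1.mono (Concept.extent_subset_extent_iff.2 has),
    s.2.2.mono (Concept.intent_subset_intent_iff.2 hsle)⟩,
    fun x hx => sInf_le (α := DedekindCut M) (mem_image_of_mem _ hx),
    fun x hx => le_sInf (α := DedekindCut M) (forall_mem_image.2 fun _ hy => hx hy)⟩

theorem exists_isLUB {S : Set (MDCompletion M)} (hne : S.Nonempty) (hS : BddAbove S) :
    ∃ x, IsLUB S x := by
  obtain ⟨s, hs⟩ := hne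
  obtain ⟨x, hx⟩ := exists_isGLB (S := upperBounds S) hS ⟨s, fun _ ha => ha hs⟩
  exact ⟨x, isGLB_upperBounds.1 hx⟩

instance [Nonempty M] : Nonempty (MDCompletion M) := ‹Nonempty M›.map toMD

noncomputable instance [Nonempty M] : ConditionallyCompletePartialOrder (MDCompletion M) where
  sSup S := Classical.epsilon (IsLUB S)
  sInf S := Classical.epsilon (IsGLB S)
  isLUB_csSup_of_directed _ _ hne hS := Classical.epsilon_spec (exists_isLUB hne hS)
  isGLB_csInf_of_directed _ _ hne hS := Classical.epsilon_spec (exists_isGLB hne hS)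

/-- The image of a cut of `M` under an order isomorphism `M ≃o N`. -/
def map (e : M ≃o N) (A : MDCompletion M) : MDCompletion N :=
  ⟨{ extent := e '' A.1.left
     intent := e '' A.1.right
     upperPolar_extent := by
      rw [← A.1.upperBounds_left]
      exact e.upperBounds_image
     lowerPolar_intent := by
      rw [← A.1.lowerBounds_right]
      exact e.lowerBounds_image }, A.2.1.image e, A.2.2.image e⟩

/-- The extension of an order isomorphism to the completions. -/
def congr (e : M ≃o N) : MDCompletion M ≃o MDCompletion N where
  toFun := map e
  invFun := map e.symm
  left_inv _ := Subtype.ext (DedekindCut.ext (e.symm_image_image _))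
  right_inv _ := Subtype.ext (DedekindCut.ext (e.image_symm_image _))
  map_rel_iff' := image_subset_image_iff e.injective

theorem congr_toMD (e : M ≃o N) (x : M) : congr e (toMD x) = toMD (e x) :=
  Subtype.ext (DedekindCut.ext (e.image_Iic x))

end MDCompletion

theorem IsConnectingSet.map {x y : M} {n : ℕ} {c : Fin (n + 1) → MDCompletion M}
    (h : IsConnectingSet x y n c) (e : M ≃o N) :
    IsConnectingSet (e x) (e y) n (MDCompletion.congr e ∘ c) where
  one_le := h.one_le
  first := (congrArg _ h.first).trans (MDCompletion.congr_toMD e x)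
  last := (congrArg _ h.last).trans (MDCompletion.congr_toMD e y)
  comparable k := by simpa only [Function.comp_apply, OrderIso.le_iff_le] using h.comparable k
  alternating i j hij := by
    simpa only [Function.comp_apply, OrderIso.lt_iff_lt] using h.alternating i j hij

theorem IsPath.map {x y : M} {P : Set (MDCompletion M)} (h : IsPath x y P) (e : M ≃o N) :
    IsPath (e x) (e y) (MDCompletion.congr e '' P) := by
  obtain ⟨n, c, hc, σ, hσ, hdisj, rfl⟩ := h
  refine ⟨n, _, hc.map e, fun k => MDCompletion.congr e '' σ k, fun k => (hσ k).image _,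
    fun i j hij => ?_, image_iUnion⟩
  rintro _ ⟨⟨x, hxi, rfl⟩, hxj⟩
  rw [(MDCompletion.congr e).injective.mem_set_image] at hxj
  exact (hdisj i j hij x ⟨hxi, hxj⟩).imp_right (congrArg _)

theorem mem_layerData_map {r : M} (e : M ≃o N) (n : ℕ) (t : M) :
    (e t ∈ (layerData (e r) n).1 ↔ t ∈ (layerData r n).1) ∧
      (e t ∈ (layerData (e r) n).2.1 ↔ t ∈ (layerData r n).2.1) ∧
      (e t ∈ (layerData (e r) n).2.2 ↔ t ∈ (layerData r n).2.2) := by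
  induction n generalizing t with
  | zero => simp [layerData]
  | succ n ih =>
    simp [layerData, e.surjective.exists, ih]

end Completion

section LinkUnion

variable {α : Type*} {w : α} {n i j : ℕ} {T : Set α} {c : ℕ → α} {S : ℕ → Set α}

/-- The point set of the path that starts at `c 0` and consists of the links `S 0, …, S (n - 1)`;
the root is put in separately because of the trivial path, which has no link. -/
def linkUnion (c : ℕ → α) (S : ℕ → Set α) (n : ℕ) : Set α := {c 0} ∪ ⋃ i < n, S i

theorem linkUnion_succ (c : ℕ → α) (S : ℕ → Set α) (n : ℕ) :
    linkUnion c S (n + 1) = linkUnion c S n ∪ S n := by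
  rw [linkUnion, biUnion_lt_succ, ← union_assoc, linkUnion]

theorem linkUnion_update {k : ℕ} (hk : k ≤ n) :
    linkUnion (Function.update c (n + 1) w) (Function.update S n T) k = linkUnion c S k := by
  have hS : ∀ i < k, Function.update S n T i = S i := fun i hi =>
    Function.update_of_ne (hi.trans_le hk).ne _ _
  rw [linkUnion, linkUnion, Function.update_of_ne (Nat.succ_ne_zero n).symm]
  exact congrArg _ (iUnion₂_congr hS)

theorem subset_linkUnion (hij : i < j) : S i ⊆ linkUnion c S j :=
  fun _ hx => Or.inr (mem_biUnion (t := S) (s := Iio j) hij hx)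

end LinkUnion

section LinkSequences

variable {P : Type*} [PartialOrder P] {r z w x : P} {n i j : ℕ} {b : Bool} {A T : Set P}
  {dir : ℕ → Bool} {c : ℕ → P} {S : ℕ → Set P}

/-- `c 0, …, c n` are the turning points and `S 0, …, S (n - 1)` the links, of alternating
directions `dir 0, …, dir (n - 1)`, of a path.  This is the form in which a `RootPath` is compared
with the paths of `IsPathVia`; only the values of the sequences up to `n` matter. -/
structure IsLinkSequence (n : ℕ) (dir : ℕ → Bool) (c : ℕ → P) (S : ℕ → Set P) : Prop where
  dir_succ : ∀ k, dir (k + 1) = !dir k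
  isLink : ∀ k < n, IsLink (linkUnion c S k) (dir k) (c k) (S k) (c (k + 1))

namespace IsLinkSequence

theorem snoc (h : IsLinkSequence n dir c S) (hT : IsLink (linkUnion c S n) (dir n) (c n) T w) :
    IsLinkSequence (n + 1) dir (Function.update c (n + 1) w) (Function.update S n T) := by
  refine ⟨h.dir_succ, fun k hk => ?_⟩
  rw [linkUnion_update (Nat.le_of_lt_succ hk), Function.update_of_ne hk.ne]
  rcases Nat.lt_succ_iff_lt_or_eq.1 hk with hk | rfl
  · rw [Function.update_of_ne hk.ne, Function.update_of_ne (by omega)]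
    exact h.isLink k hk
  · simpa only [Function.update_self] using hT

theorem eq_of_mem_of_mem (h : IsLinkSequence n dir c S) (hij : i < j) (hj : j < n)
    (hxi : x ∈ S i) (hxj : x ∈ S j) : j = i + 1 ∧ x = c (i + 1) := by
  obtain rfl : x = c j := (h.isLink j hj).inter_subset ⟨subset_linkUnion hij hxi, hxj⟩
  obtain ⟨k, rfl⟩ := Nat.exists_eq_add_one_of_ne_zero (Nat.ne_zero_of_lt hij)
  rcases Nat.lt_succ_iff_lt_or_eq.1 hij with hik | rfl
  · exact absurd (subset_linkUnion hik hxi) (h.isLink k (by omega)).right_notMem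
  · exact ⟨rfl, rfl⟩

end IsLinkSequence

theorem RootPath.exists_isLinkSequence (h : RootPath r n b A z) :
    ∃ dir c S, IsLinkSequence n dir c S ∧ dir n = (!b) ∧ c 0 = r ∧ c n = z ∧
      A = linkUnion c S n := by
  induction h with
  | nil b =>
    exact ⟨fun k => not^[k] (!b), fun _ => r, fun _ => ∅,
      ⟨fun k => Function.iterate_succ_apply' _ k _, by simp⟩, rfl, rfl, rfl, by simp [linkUnion]⟩
  | @snoc n b A T z w hA hT ih =>
    obtain ⟨dir, c, S, h, hdir, rfl, rfl, rfl⟩ := ih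
    rw [Bool.not_not] at hdir
    subst hdir
    exact ⟨dir, _, _, h.snoc hT, h.dir_succ n, Function.update_of_ne (Nat.succ_ne_zero n).symm _ _,
      Function.update_self .., by
        rw [linkUnion_succ, linkUnion_update le_rfl, Function.update_self]⟩

end LinkSequences

section Paths

variable {M : Type*} [PartialOrder M] {r t : M} {n : ℕ} {b : Bool} {z : MDCompletion M}
  {A T : Set (MDCompletion M)} {dir : ℕ → Bool} {c : ℕ → MDCompletion M}
  {S : ℕ → Set (MDCompletion M)}

theorem IsLinkSequence.isPathVia (h : IsLinkSequence n dir c S) (hn : 1 ≤ n) (hr : c 0 = toMD r)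
    (ht : c n = toMD t) : IsPathVia r t n (fun k => c k) (linkUnion c S n) := by
  refine ⟨⟨hn, hr, ht, fun k => (h.isLink k k.2).step.le_or_le, fun i j hij => ?_⟩,
    fun k => S k, fun k => (h.isLink k k.2).chain,
    fun i j hij x hx => h.eq_of_mem_of_mem hij j.2 hx.1 hx.2, ?_⟩
  · have hi := (h.isLink i i.2).step
    have hj := (h.isLink j j.2).step
    simp only [hij, h.dir_succ] at hj
    simp only [Fin.val_castSucc, Fin.val_succ, hij]
    cases hdir : dir i <;> rw [hdir] at hi hj
    · exact Or.inr ⟨hi, hj⟩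
    · exact Or.inl ⟨hi, hj⟩
  · have hroot : c 0 ∈ ⋃ i < n, S i :=
      mem_biUnion (t := S) (s := Iio n) hn (h.isLink 0 hn).chain.left_mem
    rw [linkUnion, union_eq_right.2 (singleton_subset_iff.2 hroot)]
    exact (iUnion_subtype (· < n) fun k => S k).symm.trans
      (Fin.equivSubtype.symm.surjective.iUnion_comp fun k : Fin n => S k)

theorem isPath_self (r : M) : IsPath r r {toMD r} :=
  ⟨1, fun _ => toMD r, ⟨le_rfl, rfl, rfl, fun _ => Or.inl le_rfl, fun _ _ _ => by omega⟩,
    fun _ => {toMD r}, fun _ => isMaxChainBetween_singleton _, fun _ _ _ => by omega,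
    (iUnion_const _).symm⟩

theorem RootPath.isPath (h : RootPath (toMD r) n b A (toMD t)) : IsPath r t A := by
  cases n with
  | zero =>
    obtain ⟨ht, rfl⟩ := h.eq_of_zero
    exact toMD_injective ht ▸ isPath_self r
  | succ n =>
    obtain ⟨dir, c, S, hS, -, hr, ht, rfl⟩ := h.exists_isLinkSequence
    exact ⟨_, _, hS.isPathVia n.succ_pos hr ht⟩

theorem TurningPointsIn.mem_range_toMD (hturn : TurningPointsIn r)
    (hA : RootPath (toMD r) n (!b) A z) (hT : IsLink A b z T (toMD t)) :
    z ∈ range (toMD : M → MDCompletion M) := by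
  obtain ⟨dir, c, S, hS, hdir, hr, rfl, rfl⟩ := hA.exists_isLinkSequence
  rw [Bool.not_not] at hdir
  subst hdir
  have hpath := (hS.snoc hT).isPathVia (t := t) n.succ_pos
    ((Function.update_of_ne n.succ_ne_zero.symm _ _).trans hr) (Function.update_self ..)
  have := hturn t _ _ _ hpath ⟨n, by omega⟩
  rwa [Function.update_of_ne n.lt_succ_self.ne] at this

end Paths

section PathOrder

variable {M : Type*} [PartialOrder M] {r s t u x y : M} {n m : ℕ} {b d : Bool}
  {w : MDCompletion M} {A B : Set (MDCompletion M)}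

/-- `s` lies on a path from `r` to `t`: the relation `s ≤_T t` of the tree with root `r`. -/
def OnPath (r s t : M) : Prop := ∃ P, IsPath r t P ∧ toMD s ∈ P

theorem IsCFPO.eq_of_rootPath (hcf : IsCFPO M) (hA : RootPath (toMD r) n b A (toMD t))
    (hB : RootPath (toMD r) m d B (toMD t)) : A = B :=
  hcf r t A B hA.isPath hB.isPath

theorem RootPath.onPath_iff (hA : RootPath (toMD r) n b A (toMD t)) (hcf : IsCFPO M) :
    OnPath r s t ↔ toMD s ∈ A :=
  ⟨fun ⟨P, hP, hs⟩ => hcf r t P A hP hA.isPath ▸ hs, fun hs => ⟨A, hA.isPath, hs⟩⟩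

theorem IsPathConnectedOrder.exists_rootPath (hconn : IsPathConnectedOrder M) (r t : M) :
    ∃ n b A, RootPath (toMD r) n b A (toMD t) := by
  have : Nonempty M := ⟨r⟩
  obtain ⟨P, n, c, hc, -⟩ := hconn r t
  have hreach : ∀ k, ∃ m b A, RootPath (toMD r) m b A (c k) := by
    intro k
    induction k using Fin.induction with
    | zero =>
      rw [hc.first]
      exact ⟨0, true, _, .nil true⟩
    | succ i ih =>
      obtain ⟨m, b, A, hA⟩ := ih
      exact hA.exists_of_le_or_le (hc.comparable i)
  exact hc.last ▸ hreach (Fin.last n)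

theorem IsCFPO.subset_of_mem (hcf : IsCFPO M) (hA : RootPath (toMD r) n b A w)
    (hB : RootPath (toMD r) m d B (toMD s)) (hs : toMD s ∈ A) :
    B ⊆ A ∧ (w ∈ B → toMD s = w) := by
  have : Nonempty M := ⟨r⟩
  obtain ⟨_, _, B', p, hB', hBA, hp, hend⟩ := hA.exists_first_hit (a := toMD s) (c := toMD s)
    ⟨_, hs, left_mem_symmIcc (Or.inl le_rfl)⟩
  have hps : p ∈ B' ∩ symmIcc (toMD s) (toMD s) := hp.symm.subset rfl
  rw [symmIcc_self] at hps
  obtain rfl : p = toMD s := hps.2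
  exact hcf.eq_of_rootPath hB hB' ▸ ⟨hBA, hend⟩

theorem onPath_refl (hconn : IsPathConnectedOrder M) (r t : M) : OnPath r t t := by
  obtain ⟨n, b, A, hA⟩ := hconn.exists_rootPath r t
  exact ⟨A, hA.isPath, hA.end_mem⟩

theorem onPath_root_left (hconn : IsPathConnectedOrder M) (r t : M) : OnPath r r t := by
  obtain ⟨n, b, A, hA⟩ := hconn.exists_rootPath r t
  exact ⟨A, hA.isPath, hA.root_mem⟩

theorem eq_root_of_onPath_root (hcf : IsCFPO M) (h : OnPath r s r) : s = r :=
  toMD_injective (((RootPath.nil true).onPath_iff hcf).1 h)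

theorem OnPath.trans (hst : OnPath r s t) (htu : OnPath r t u) (hcf : IsCFPO M)
    (hconn : IsPathConnectedOrder M) : OnPath r s u := by
  obtain ⟨n, b, A, hA⟩ := hconn.exists_rootPath r t
  obtain ⟨m, d, B, hB⟩ := hconn.exists_rootPath r u
  exact (hB.onPath_iff hcf).2
    ((hcf.subset_of_mem hB hA ((hB.onPath_iff hcf).1 htu)).1 ((hA.onPath_iff hcf).1 hst))

theorem OnPath.antisymm (hst : OnPath r s t) (hts : OnPath r t s) (hcf : IsCFPO M)
    (hconn : IsPathConnectedOrder M) : s = t := by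
  obtain ⟨n, b, A, hA⟩ := hconn.exists_rootPath r t
  obtain ⟨m, d, B, hB⟩ := hconn.exists_rootPath r s
  exact toMD_injective ((hcf.subset_of_mem hA hB ((hA.onPath_iff hcf).1 hst)).2
    ((hB.onPath_iff hcf).1 hts))

theorem OnPath.total (hx : OnPath r x t) (hy : OnPath r y t) (hcf : IsCFPO M)
    (hconn : IsPathConnectedOrder M) : OnPath r x y ∨ OnPath r y x := by
  obtain ⟨n, b, A, hA⟩ := hconn.exists_rootPath r t
  exact (hA.exists_mem_or_exists_mem ((hA.onPath_iff hcf).1 hx) ((hA.onPath_iff hcf).1 hy)).imp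
    (fun ⟨_, _, B, hB, h⟩ => ⟨B, hB.isPath, h⟩) fun ⟨_, _, B, hB, h⟩ => ⟨B, hB.isPath, h⟩

theorem isTree_treeOf {ι : Type*} (C : ι → Set M) (hcf : IsCFPO M)
    (hconn : IsPathConnectedOrder M) (r : M) : (treeOf C r).IsTree where
  refl := onPath_refl hconn r
  trans _ _ _ hxy hyz := OnPath.trans hxy hyz hcf hconn
  antisymm _ _ hxy hyx := OnPath.antisymm hxy hyx hcf hconn
  linear_below _ _ _ hx hy := OnPath.total hx hy hcf hconn
  common_lower_bound x y := ⟨r, onPath_root_left hconn r x, onPath_root_left hconn r y⟩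

end PathOrder

section Arrival

variable {M : Type*} [PartialOrder M] {r t y y' : M} {n m : ℕ} {b d : Bool}
  {a : MDCompletion M} {A B S T : Set (MDCompletion M)}

/-- `t` is reached from `r` by a path of `n` links, the last of which has direction `b`. -/
def ArrivesIn (r : M) (n : ℕ) (b : Bool) (t : M) : Prop :=
  ∃ A, RootPath (toMD r) n b A (toMD t)

/-- `t` is reached from `r` by a path whose last link has direction `b`; the root is reached in
both directions. -/
def ArrivesBy (r : M) (b : Bool) (t : M) : Prop := ∃ n, ArrivesIn r n b t

theorem IsCFPO.not_isStep_of_mem (hcf : IsCFPO M) (hA : RootPath (toMD r) (n + 1) b A (toMD t))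
    (ha : a ∈ A) : ¬ IsStep b (toMD t) a := by
  have : Nonempty M := ⟨r⟩
  intro hta
  obtain ⟨z, B, S, hB, hS, rfl⟩ := hA.exists_isLink_of_succ
  have haB : a ∈ B := ha.resolve_right fun haS =>
    (hS.eq_or_isStep_right haS).elim hta.ne.symm hta.asymm
  obtain ⟨m, d, D, p, hD, hDB, hp, hend⟩ :=
    hB.exists_first_hit ⟨a, haB, right_mem_symmIcc hta.le_or_le⟩
  have hpm : p ∈ D ∩ symmIcc (toMD t) a := hp.symm.subset rfl
  have htp : IsStep b (toMD t) p := (hta.mem_symmIcc_iff.1 hpm.2).1.resolve_left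
    fun hpt => hS.right_notMem (hpt ▸ hDB hpm.1)
  obtain ⟨T, hT⟩ := exists_isLink hp (left_mem_symmIcc hta.le_or_le) (isStep_not.2 htp)
  obtain ⟨k, -, hk⟩ := hD.exists_append hT
  have hz : z ∈ D ∪ T := hcf.eq_of_rootPath hA hk ▸ Or.inl hB.end_mem
  rcases hz with hzD | hzT
  · exact htp.asymm (hend hzD ▸ hS.step)
  · exact (hT.eq_or_isStep_right hzT).elim hS.step.ne fun h => hS.step.asymm (isStep_not.1 h)

theorem IsCFPO.not_rootPath_succ_root (hcf : IsCFPO M) :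
    ¬ RootPath (toMD r) (n + 1) b A (toMD r) := by
  intro hA
  obtain ⟨z, B, S, hB, hS, rfl⟩ := hA.exists_isLink_of_succ
  exact hS.step.ne (hcf.eq_of_rootPath hA (.nil b) ▸ Or.inl hB.end_mem : z ∈ ({toMD r} : Set _))

theorem IsCFPO.direction_eq (hcf : IsCFPO M) (hA : RootPath (toMD r) (n + 1) b A (toMD t))
    (hB : RootPath (toMD r) (m + 1) d B (toMD t)) : b = d := by
  obtain ⟨z, B', S, hB', hS, rfl⟩ := hB.exists_isLink_of_succ
  by_contra hbd
  obtain rfl : d = !b := Bool.eq_not.2 (Ne.symm hbd)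
  exact hcf.not_isStep_of_mem hA (hcf.eq_of_rootPath hA hB ▸ Or.inl hB'.end_mem)
    (isStep_not.1 hS.step)

theorem IsCFPO.eq_root_of_arrivesBy (hcf : IsCFPO M) (h : ArrivesBy r b t)
    (h' : ArrivesBy r (!b) t) : t = r := by
  obtain ⟨_ | n, A, hA⟩ := h
  · exact toMD_injective hA.eq_of_zero.1
  obtain ⟨_ | m, B, hB⟩ := h'
  · exact toMD_injective hB.eq_of_zero.1
  · exact absurd (hcf.direction_eq hA hB) (Bool.not_ne_self b).symm

theorem arrivesBy_not_iff (hcf : IsCFPO M) (hconn : IsPathConnectedOrder M) (ht : t ≠ r) :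
    ArrivesBy r (!b) t ↔ ¬ ArrivesBy r b t := by
  refine ⟨fun h h' => ht (hcf.eq_root_of_arrivesBy h' h), fun h => ?_⟩
  obtain ⟨n, d, A, hA⟩ := hconn.exists_rootPath r t
  obtain rfl | rfl := Bool.eq_or_eq_not d b
  · exact absurd ⟨n, A, hA⟩ h
  · exact ⟨n, A, hA⟩

theorem IsCFPO.eq_of_mem_link (hcf : IsCFPO M) (hS : IsLink A b (toMD y) S (toMD t))
    (hB : RootPath (toMD r) m (!b) B (toMD y')) (hT : IsLink B b (toMD y') T (toMD t))
    (hy : toMD y ∈ B ∪ T) (hy' : toMD y' ∈ S) : y = y' := by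
  by_contra hne
  have hne' := toMD_injective.ne hne
  have hyy' := (hS.eq_or_isStep_left hy').resolve_left hne'.symm
  have hyB : toMD y ∈ B := hy.resolve_right fun hyT =>
    (hT.eq_or_isStep_left hyT).elim hne' hyy'.asymm
  cases m with
  | zero =>
    obtain ⟨hy'r, rfl⟩ := hB.eq_of_zero
    exact hne' (hyB.trans hy'r.symm)
  | succ m => exact hcf.not_isStep_of_mem hB hyB (isStep_not.2 hyy')

theorem IsCFPO.last_turningPoint_eq (hcf : IsCFPO M) (hA : RootPath (toMD r) n (!b) A (toMD y))
    (hS : IsLink A b (toMD y) S (toMD t)) (hB : RootPath (toMD r) m (!b) B (toMD y'))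
    (hT : IsLink B b (toMD y') T (toMD t)) : y = y' := by
  have hAB := hcf.eq_of_rootPath (.snoc hA hS) (.snoc hB hT)
  have hy : toMD y ∈ B ∪ T := hAB ▸ Or.inl hA.end_mem
  have hy' : toMD y' ∈ A ∪ S := hAB ▸ Or.inl hB.end_mem
  rcases hy' with hy'A | hy'S
  · rcases hy with hyB | hyT
    · exact toMD_injective ((hcf.subset_of_mem hA hB hy'A).2 hyB).symm
    · exact (hcf.eq_of_mem_link hT hA hS (Or.inl hy'A) hyT).symm
  · exact hcf.eq_of_mem_link hS hB hT hy hy'S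

theorem IsCFPO.length_eq (hcf : IsCFPO M) (hturn : TurningPointsIn r)
    (hA : RootPath (toMD r) n b A (toMD t)) (hB : RootPath (toMD r) m d B (toMD t)) : n = m := by
  induction n generalizing m b d A B t with
  | zero =>
    cases m with
    | zero => rfl
    | succ m =>
      obtain rfl := toMD_injective hA.eq_of_zero.1
      exact absurd hB hcf.not_rootPath_succ_root
  | succ n ih =>
    cases m with
    | zero =>
      obtain rfl := toMD_injective hB.eq_of_zero.1
      exact absurd hA hcf.not_rootPath_succ_root
    | succ m =>
      obtain rfl := hcf.direction_eq hA hB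
      obtain ⟨_, A', S, hA', hS, rfl⟩ := hA.exists_isLink_of_succ
      obtain ⟨_, B', T, hB', hT, rfl⟩ := hB.exists_isLink_of_succ
      obtain ⟨y, rfl⟩ := hturn.mem_range_toMD hA' hS
      obtain ⟨y', rfl⟩ := hturn.mem_range_toMD hB' hT
      obtain rfl := hcf.last_turningPoint_eq hA' hS hB' hT
      exact congrArg (· + 1) (ih hA' hB')

end Arrival

section Ioc

variable {α : Type*} {le : α → α → Prop} {c c' : Set α} {z t : α}

/-- `z` is below `t` and the half-open interval `(z, t]` is contained in `c`, for a relation `le`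
in place of an order instance: it will be applied to `≤_T` on a set with its own order. -/
def IocSubset (le : α → α → Prop) (c : Set α) (z t : α) : Prop :=
  le z t ∧ ∀ u, le z u → u ≠ z → le u t → u ∈ c

theorem iocSubset_congr (h : ∀ u, le z u → u ≠ z → (u ∈ c ↔ u ∈ c')) :
    IocSubset le c z t ↔ IocSubset le c' z t :=
  and_congr_right fun _ => forall_congr' fun u => forall_congr' fun hzu => forall_congr' fun hne =>
    imp_congr_right fun _ => h u hzu hne

theorem iocSubset_apply_iff {g : Equiv.Perm α} (hle : ∀ x y, le (g x) (g y) ↔ le x y)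
    (hc : ∀ x, g x ∈ c ↔ x ∈ c) : IocSubset le c (g z) (g t) ↔ IocSubset le c z t :=
  and_congr (hle z t) (g.surjective.forall.trans (forall_congr' fun u => by
    rw [hle, hle, hc, g.injective.ne_iff]))

end Ioc

section Recovery

variable {M : Type*} [PartialOrder M] {r s t z : M} {m : ℕ} {b d : Bool}
  {B S : Set (MDCompletion M)}

theorem IsPathConnectedOrder.exists_rootPath_between (hconn : IsPathConnectedOrder M) (r : M)
    (h : IsStep b s t) : ∃ k d B p, RootPath (toMD r) k d B p ∧
      (p = toMD s ∨ ∃ S, IsLink B (!b) p S (toMD s)) ∧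
        (p = toMD t ∨ ∃ S, IsLink B b p S (toMD t)) := by
  have : Nonempty M := ⟨r⟩
  have hst := isStep_toMD.2 h
  obtain ⟨n, e, A, hA⟩ := hconn.exists_rootPath r s
  obtain ⟨k, d, B, p, hB, -, hp, -⟩ :=
    hA.exists_first_hit ⟨_, hA.end_mem, left_mem_symmIcc hst.le_or_le⟩
  obtain ⟨hps, hpt⟩ :=
    hst.mem_symmIcc_iff.1 (hp.symm.subset rfl : p ∈ B ∩ symmIcc (toMD s) (toMD t)).2
  exact ⟨k, d, B, p, hB,
    hps.imp_right fun h => exists_isLink hp (left_mem_symmIcc hst.le_or_le) (isStep_not.2 h),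
    hpt.imp_right (exists_isLink hp (right_mem_symmIcc hst.le_or_le))⟩

theorem IocSubset.eq_or_isStep (h : IocSubset (OnPath r) {u | ArrivesBy r b u} z t)
    (hcf : IsCFPO M) (hconn : IsPathConnectedOrder M) (hturn : TurningPointsIn r) :
    z = t ∨ IsStep b z t := by
  refine or_iff_not_imp_left.2 fun hzt => ?_
  obtain ⟨_ | n, A, hA⟩ := h.2 t h.1 (Ne.symm hzt) (onPath_refl hconn r t)
  · obtain rfl := toMD_injective hA.eq_of_zero.1
    exact absurd (eq_root_of_onPath_root hcf h.1) hzt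
  obtain ⟨_, B, S, hB, hS, rfl⟩ := hA.exists_isLink_of_succ
  obtain ⟨y, rfl⟩ := hturn.mem_range_toMD hB hS
  rcases (hA.onPath_iff hcf).1 h.1 with hzB | hzS
  · obtain rfl : y = z := by
      by_contra hyz
      have hzy : OnPath r z y := (hB.onPath_iff hcf).2 hzB
      have hyb := h.2 y hzy hyz ⟨_, hA.isPath, Or.inl hB.end_mem⟩
      obtain rfl := hcf.eq_root_of_arrivesBy hyb ⟨n, B, hB⟩
      exact hyz (eq_root_of_onPath_root hcf hzy).symm
    exact isStep_toMD.1 hS.step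
  · exact isStep_toMD.1 ((hS.eq_or_isStep_right hzS).resolve_left (toMD_injective.ne hzt))

theorem iocSubset_self (hcf : IsCFPO M) (hconn : IsPathConnectedOrder M) (c : Set M) :
    IocSubset (OnPath r) c t t :=
  ⟨onPath_refl hconn r t, fun _ htu hne hut => absurd (hut.antisymm htu hcf hconn) hne⟩

theorem IsLink.iocSubset (hS : IsLink B b (toMD z) S (toMD t))
    (hB : RootPath (toMD r) m d B (toMD z)) (hcf : IsCFPO M) (hconn : IsPathConnectedOrder M) :
    IocSubset (OnPath r) {u | ArrivesBy r b u} z t := by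
  obtain ⟨k, -, hk⟩ := hB.exists_append hS
  refine ⟨(hk.onPath_iff hcf).2 (Or.inl hB.end_mem), fun u hzu huz hut => ?_⟩
  have huS : toMD u ∈ S := ((hk.onPath_iff hcf).1 hut).resolve_left fun huB =>
    huz (((hB.onPath_iff hcf).2 huB).antisymm hzu hcf hconn)
  obtain ⟨j, -, hj⟩ := hB.exists_append (hS.truncate huS (toMD_injective.ne huz))
  exact ⟨j, _, hj⟩

theorem exists_iocSubset_of_isStep (hcf : IsCFPO M) (hconn : IsPathConnectedOrder M)
    (hturn : TurningPointsIn r) (h : IsStep b s t) :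
    ∃ z, IocSubset (OnPath r) {u | ArrivesBy r (!b) u} z s ∧
      IocSubset (OnPath r) {u | ArrivesBy r b u} z t := by
  obtain ⟨k, d, B, p, hB, hs, ht⟩ := hconn.exists_rootPath_between r h
  obtain ⟨z, rfl⟩ : p ∈ range (toMD : M → MDCompletion M) := by
    rcases hs with rfl | ⟨S, hS⟩
    · exact ⟨s, rfl⟩
    rcases ht with rfl | ⟨T, hT⟩
    · exact ⟨t, rfl⟩
    obtain rfl | rfl := Bool.eq_or_eq_not d b
    · exact hturn.mem_range_toMD (d.not_not.symm ▸ hB) hS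
    · exact hturn.mem_range_toMD hB hT
  refine ⟨z, ?_, ?_⟩
  · rcases hs with hzs | ⟨S, hS⟩
    · exact toMD_injective hzs ▸ iocSubset_self hcf hconn _
    · exact hS.iocSubset hB hcf hconn
  · rcases ht with hzt | ⟨T, hT⟩
    · exact toMD_injective hzt ▸ iocSubset_self hcf hconn _
    · exact hT.iocSubset hB hcf hconn

theorem le_iff_exists_iocSubset (hcf : IsCFPO M) (hconn : IsPathConnectedOrder M)
    (hturn : TurningPointsIn r) : s ≤ t ↔
      ∃ z, IocSubset (OnPath r) {u | ArrivesBy r true u}ᶜ z s ∧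
        IocSubset (OnPath r) {u | ArrivesBy r true u} z t := by
  have hcompl (z s : M) : IocSubset (OnPath r) {u | ArrivesBy r true u}ᶜ z s ↔
      IocSubset (OnPath r) {u | ArrivesBy r false u} z s := by
    refine iocSubset_congr fun u hzu hne => (arrivesBy_not_iff hcf hconn ?_).symm
    rintro rfl
    exact hne (eq_root_of_onPath_root hcf hzu).symm
  rw [exists_congr fun z => and_congr_left' (hcompl z s)]
  refine ⟨fun hst => ?_, fun ⟨z, hs, ht⟩ => ?_⟩
  · rcases hst.eq_or_lt with rfl | hlt
    · exact ⟨s, iocSubset_self hcf hconn _, iocSubset_self hcf hconn _⟩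
    · exact exists_iocSubset_of_isStep (b := true) hcf hconn hturn hlt
  · have hsz : s ≤ z := (hs.eq_or_isStep hcf hconn hturn).elim Eq.ge le_of_lt
    have hzt : z ≤ t := (ht.eq_or_isStep hcf hconn hturn).elim Eq.le le_of_lt
    exact hsz.trans hzt

end Recovery

section Layers

variable {M : Type*} [PartialOrder M] {r t y : M} {n m : ℕ} {b d : Bool}

theorem ArrivesIn.length_eq (h : ArrivesIn r n b t) (h' : ArrivesIn r m d t) (hcf : IsCFPO M)
    (hturn : TurningPointsIn r) : n = m := by
  obtain ⟨A, hA⟩ := h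
  obtain ⟨B, hB⟩ := h'
  exact hcf.length_eq hturn hA hB

theorem arrivesIn_zero_iff : ArrivesIn r 0 b t ↔ t = r := by
  refine ⟨fun ⟨A, hA⟩ => toMD_injective hA.eq_of_zero.1, ?_⟩
  rintro rfl
  exact ⟨_, .nil b⟩

theorem ArrivesIn.exists_isStep (h : ArrivesIn r (n + 1) b t) (hturn : TurningPointsIn r) :
    ∃ y, ArrivesIn r n (!b) y ∧ IsStep b y t := by
  obtain ⟨A, hA⟩ := h
  obtain ⟨_, B, S, hB, hS, -⟩ := hA.exists_isLink_of_succ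
  obtain ⟨y, rfl⟩ := hturn.mem_range_toMD hB hS
  exact ⟨y, ⟨B, hB⟩, isStep_toMD.1 hS.step⟩

theorem ArrivesIn.succ_of_isStep (hy : ArrivesIn r n (!b) y) (h : IsStep b y t) (hnm : n ≤ m)
    (ht : ¬ ∃ k ≤ m, ∃ d, ArrivesIn r k d t) (hcf : IsCFPO M) (hconn : IsPathConnectedOrder M)
    (hturn : TurningPointsIn r) : ArrivesIn r (m + 1) b t := by
  obtain ⟨k, d, B, p, hB, hpy, hpt⟩ := hconn.exists_rootPath_between r h
  have hkn : k ≤ n := by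
    rcases hpy with rfl | ⟨S, hS⟩
    · exact (ArrivesIn.length_eq ⟨B, hB⟩ hy hcf hturn).le
    · obtain ⟨j, hj, hpath⟩ := hB.exists_append hS
      have := ArrivesIn.length_eq ⟨_, hpath⟩ hy hcf hturn
      omega
  rcases hpt with rfl | ⟨S, hS⟩
  · exact absurd ⟨k, hkn.trans hnm, d, B, hB⟩ ht
  · obtain ⟨j, hj, hpath⟩ := hB.exists_append hS
    have hmj : m < j := not_le.1 fun hjm => ht ⟨j, hjm, b, _, hpath⟩
    obtain rfl : j = m + 1 := by omega
    exact ⟨_, hpath⟩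

theorem arrivesIn_one_iff (hcf : IsCFPO M) (hconn : IsPathConnectedOrder M)
    (hturn : TurningPointsIn r) : ArrivesIn r 1 b t ↔ IsStep b r t := by
  constructor
  · intro h
    obtain ⟨y, hy, hyt⟩ := h.exists_isStep hturn
    exact arrivesIn_zero_iff.1 hy ▸ hyt
  · intro h
    refine (arrivesIn_zero_iff.2 rfl).succ_of_isStep h le_rfl ?_ hcf hconn hturn
    rintro ⟨k, hk, d, hd⟩
    obtain rfl := Nat.le_zero.1 hk
    exact h.ne (arrivesIn_zero_iff.1 hd).symm

/-- The layers of `M` indexed by the direction in which they are entered: `X_n` for `true` and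
`Y_n` for `false`. -/
def layerOf (r : M) : Bool → ℕ → Set M
  | true => layerX r
  | false => layerY r

theorem mem_layerOf_zero : t ∈ layerOf r b 0 ↔ IsStep b r t ∨ b = true ∧ t = r := by
  cases b
  · simp only [layerOf, layerY_zero, mem_ofPred_eq, IsStep, Bool.false_eq_true, false_and, or_false]
  · simp only [layerOf, layerX_zero, mem_ofPred_eq, IsStep, true_and, le_iff_lt_or_eq, eq_comm]

theorem mem_layerData_union_zero :
    t ∈ (layerData r 0).2.2 ↔ t = r ∨ ∃ b, IsStep b r t := by
  simp only [layerData, Bool.exists_bool, IsStep, mem_union, mem_ofPred_eq, le_iff_eq_or_lt]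
  tauto

theorem mem_layerData_union_succ :
    t ∈ (layerData r (n + 1)).2.2 ↔
      t ∈ (layerData r n).2.2 ∨ ∃ b, t ∈ layerOf r b (n + 1) := by
  rw [Bool.exists_bool, or_comm (a := t ∈ layerOf r false (n + 1))]
  rfl

theorem mem_layerOf_succ : t ∈ layerOf r b (n + 1) ↔
    (∃ y ∈ layerOf r (!b) n, IsStep b y t) ∧ t ∉ (layerData r n).2.2 := by
  cases b
  · exact Iff.rfl
  refine and_congr_left fun ht => exists_congr fun y => and_congr_right fun hy => ?_
  have hyt : y ≠ t := by
    rintro rfl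
    rw [layerData_union] at ht
    exact ht (mem_biUnion (Nat.lt_succ_self n) (Or.inr hy))
  exact ⟨fun h => lt_of_le_of_ne h hyt, le_of_lt⟩

theorem mem_layerOf_iff_and_mem_layerData_union_iff (hcf : IsCFPO M)
    (hconn : IsPathConnectedOrder M) (hturn : TurningPointsIn r) (n : ℕ) :
    (∀ b t, t ∈ layerOf r b n ↔ ArrivesIn r (n + 1) b t ∨ n = 0 ∧ b = true ∧ t = r) ∧
      ∀ t, t ∈ (layerData r n).2.2 ↔ ∃ k ≤ n + 1, ∃ b, ArrivesIn r k b t := by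
  induction n with
  | zero =>
    refine ⟨fun b t => ?_, fun t => ?_⟩
    · rw [mem_layerOf_zero, arrivesIn_one_iff hcf hconn hturn, eq_self, true_and]
    · simp [mem_layerData_union_zero, Nat.le_one_iff_eq_zero_or_eq_one, or_and_right, exists_or,
        arrivesIn_zero_iff, arrivesIn_one_iff hcf hconn hturn]
  | succ n ih =>
    obtain ⟨ihlayer, ihunion⟩ := ih
    have hlayer : ∀ b t, t ∈ layerOf r b (n + 1) ↔ ArrivesIn r (n + 2) b t := by
      intro b t
      rw [mem_layerOf_succ, ihunion]
      constructor
      · rintro ⟨⟨y, hy, hyt⟩, ht⟩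
        rcases (ihlayer _ y).1 hy with hy | ⟨-, -, hyr⟩
        · exact hy.succ_of_isStep hyt le_rfl ht hcf hconn hturn
        · exact (arrivesIn_zero_iff.2 hyr).succ_of_isStep hyt (Nat.zero_le _) ht hcf hconn hturn
      · intro h
        obtain ⟨y, hy, hyt⟩ := h.exists_isStep hturn
        refine ⟨⟨y, (ihlayer _ y).2 (Or.inl hy), hyt⟩, fun ⟨k, hk, d, hd⟩ => ?_⟩
        have := hd.length_eq h hcf hturn
        omega
    refine ⟨fun b t => by simp [hlayer], fun t => ?_⟩
    simp only [mem_layerData_union_succ, ihunion, hlayer]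
    simp only [Nat.le_succ_iff (n := n + 1), or_and_right, exists_or, exists_eq_left]

theorem mem_iUnion_layerX_iff (hcf : IsCFPO M) (hconn : IsPathConnectedOrder M)
    (hturn : TurningPointsIn r) : t ∈ ⋃ n, layerX r n ↔ ArrivesBy r true t := by
  have hlayer (n : ℕ) := (mem_layerOf_iff_and_mem_layerData_union_iff hcf hconn hturn n).1 true t
  rw [mem_iUnion]
  constructor
  · rintro ⟨n, hn⟩
    rcases (hlayer n).1 hn with h | ⟨-, -, h⟩
    · exact ⟨n + 1, h⟩
    · exact ⟨0, arrivesIn_zero_iff.2 h⟩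
  · rintro ⟨_ | n, h⟩
    · exact ⟨0, (hlayer 0).2 (Or.inr ⟨rfl, rfl, arrivesIn_zero_iff.1 h⟩)⟩
    · exact ⟨n, (hlayer n).2 (Or.inl h)⟩

end Layers

section Automorphisms

variable {M N ι : Type*} [PartialOrder M] [PartialOrder N] {C : ι → Set M} {r s t : M}

theorem OnPath.map (h : OnPath r s t) (e : M ≃o N) : OnPath (e r) (e s) (e t) := by
  obtain ⟨P, hP, hs⟩ := h
  exact ⟨_, hP.map e, MDCompletion.congr_toMD e s ▸ mem_image_of_mem _ hs⟩

theorem onPath_map_iff (e : M ≃o N) : OnPath (e r) (e s) (e t) ↔ OnPath r s t :=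
  ⟨fun h => by simpa only [e.symm_apply_apply] using h.map e.symm, fun h => h.map e⟩

theorem mem_iUnion_layerX_map_iff (e : M ≃o N) :
    e t ∈ ⋃ n, layerX (e r) n ↔ t ∈ ⋃ n, layerX r n := by
  simp only [mem_iUnion]
  exact exists_congr fun n => (mem_layerData_map e n t).1

theorem aut_colouredOrder_le_aut_treeOf (hr : ∀ g ∈ (colouredOrder C).Aut, g r = r) :
    (colouredOrder C).Aut ≤ (treeOf C r).Aut := by
  intro g hg
  let e : M ≃o M := ⟨g, fun {x y} => hg.1 x y⟩
  have her : e r = r := hr g hg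
  refine ⟨fun x y => ?_, ?_⟩
  · have h := onPath_map_iff (r := r) (s := x) (t := y) e
    rwa [her] at h
  · rintro (_ | i) x
    · have h := mem_iUnion_layerX_map_iff (r := r) (t := x) e
      rwa [her] at h
    · exact hg.2 i x

theorem aut_treeOf_le_aut_colouredOrder (hcf : IsCFPO M) (hconn : IsPathConnectedOrder M)
    (hturn : TurningPointsIn r) : (treeOf C r).Aut ≤ (colouredOrder C).Aut := by
  intro g hg
  have hU : ∀ u, ArrivesBy r true (g u) ↔ ArrivesBy r true u := fun u => by
    simpa only [treeOf, mem_iUnion_layerX_iff hcf hconn hturn] using hg.2 none u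
  refine ⟨fun x y => ?_, fun i => hg.2 (some i)⟩
  change g x ≤ g y ↔ x ≤ y
  rw [le_iff_exists_iocSubset hcf hconn hturn, le_iff_exists_iocSubset hcf hconn hturn,
    g.surjective.exists]
  exact exists_congr fun z => and_congr
    (iocSubset_apply_iff hg.1 fun u => not_congr (hU u)) (iocSubset_apply_iff hg.1 hU)

end Automorphisms

theorem mainTheorem1 {M : Type*} [PartialOrder M] {ι : Type*} (C : ι → Set M)
    (hcf : IsCFPO M) (hconn : IsPathConnectedOrder M)
    (r : M) (hr : ∀ g ∈ (colouredOrder C).Aut, g r = r)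
    (hturn : TurningPointsIn r) :
    (treeOf C r).IsTree ∧ PermGroupIso (colouredOrder C).Aut (treeOf C r).Aut :=
  ⟨isTree_treeOf C hcf hconn r,
    MulEquiv.subgroupCongr (le_antisymm (aut_colouredOrder_le_aut_treeOf hr)
      (aut_treeOf_le_aut_colouredOrder hcf hconn hturn)), Equiv.refl M, fun _ _ => rfl⟩
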